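/- Let $k$ be a field and $\mathbb P^3=\mathbb P^3_k$. A monad is a complex $\mathcal C\xrightarrow{\alpha}\mathcal B\xrightarrow{\beta}\mathcal A$ of vector bundles on $\mathbb P^3$ with $\alpha$ injective and $\beta$ surjective; its cohomology is $\mathcal E=\ker\beta/\operatorname{im}\alpha$. A rank $2$ vector bundle $\mathcal E$ on $\mathbb P^3$ is called stable if $c_1(\mathcal L)<\tfrac12c_1(\mathcal E)$ for every invertible subsheaf $\mathcal L\subset\mathcal E$. (1) Let $a_1,a_2,b$ be integers with $a_2\ge b>a_1\ge 0$ and $2b-a_2\ge 0$, let $g\ge 0$ be an integer and let $B$ be a vector bundle of rank $2g+2$ on $\mathbb P^3$. Let $\mathcal E$ be a rank $2$ vector bundle with $c_1(\mathcal E)\le 0$ (for instance $c_1(\mathcal E)=-1$) that is the cohomology of a monad $$\mathcal O(-a_2-1)\oplus\mathcal O(-a_1-1)^{\oplus g}\longrightarrow \mathcal O(b)^{\oplus 2}\oplus B\longrightarrow \mathcal O(a_2)\oplus\mathcal O(a_1)^{\oplus g}.$$ Then $\mathcal E$ is not stable. (2) In particular, let $\mathcal E$ be a rank $2$ vector bundle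 with $c_1(\mathcal E)=-1$ that is the cohomology of a monad $$\mathcal O(-5)\oplus\mathcal O(-2)\longrightarrow \mathcal O(2)^{\oplus 2}\oplus\mathcal O\oplus\mathcal O(-1)\oplus\mathcal O(-3)^{\oplus 2}\longrightarrow \mathcal O(4)\oplus\mathcal O(1).$$ Then $\mathcal E$ is not stable. -/

import Mathlib

open CategoryTheory CategoryTheory.Limits TopologicalSpace Opposite AlgebraicGeometry

noncomputable section

namespace HorrocksMonads

universe u

section Twist

variable {A : Type u} {σ : Type*} [CommRing A] [SetLike σ A] [AddSubgroupClass σ A]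
variable (𝒜 : ℕ → σ) [GradedRing 𝒜]

/-- The localization of `A` at a point of `Proj 𝒜`. -/
abbrev LocAt (x : ProjectiveSpectrum 𝒜) : Type u :=
  Localization.AtPrime x.asHomogeneousIdeal.toIdeal

variable {𝒜} in
/-- `s` is given on all of `U` by one fraction `a / t`, where `a` and `t` are homogeneous with
`deg a = deg t + d` and `t` vanishes nowhere on `U`. -/
def IsTwistFraction (d : ℤ) {U : Opens (ProjectiveSpectrum.top 𝒜)}
    (s : ∀ x : U, LocAt 𝒜 x.1) : Prop :=
  ∃ (i j : ℕ) (a t : A), (i : ℤ) = j + d ∧ a ∈ 𝒜 i ∧ t ∈ 𝒜 j ∧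
    ∃ ht : ∀ x : U, t ∉ x.1.asHomogeneousIdeal.toIdeal,
      ∀ x : U, s x = Localization.mk a ⟨t, ht x⟩

/-- Being locally a fraction of degree `d`. -/
def twistPredicate (d : ℤ) :
    TopCat.LocalPredicate (X := ProjectiveSpectrum.top 𝒜) (fun x => LocAt 𝒜 x) :=
  TopCat.PrelocalPredicate.sheafify
    { pred := fun s => IsTwistFraction d s
      res := by
        rintro V U i f ⟨m, n, a, t, h, ha, ht, hn, hf⟩
        exact ⟨m, n, a, t, h, ha, ht, fun x => hn (i x), fun x => hf (i x)⟩ }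

/-- A section of the structure sheaf acts by multiplication in each localization. -/
instance moduleLoc (U : (Opens (ProjectiveSpectrum.top 𝒜))ᵒᵖ) :
    Module ((ProjectiveSpectrum.Proj.structureSheaf 𝒜).1.obj U)
      (∀ x : U.unop, LocAt 𝒜 x.1) where
  smul r s := fun x => (r.1 x).val * s x
  one_smul s := by
    funext x
    exact (congrArg (· * s x) (HomogeneousLocalization.val_one)).trans (one_mul _)
  mul_smul r r' s := by
    funext x
    exact (congrArg (· * s x) (HomogeneousLocalization.val_mul _ _)).trans (mul_assoc _ _ _)
  smul_zero r := by funext x; exact mul_zero _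
  smul_add r s t := by funext x; exact mul_add _ _ _
  add_smul r r' s := by
    funext x
    exact (congrArg (· * s x) (HomogeneousLocalization.val_add _ _)).trans (add_mul _ _ _)
  zero_smul s := by
    funext x
    exact (congrArg (· * s x) (HomogeneousLocalization.val_zero)).trans (zero_mul _)

theorem exists_notMem (x : ProjectiveSpectrum 𝒜) :
    ∃ (t : A) (m : ℕ), 0 < m ∧ t ∈ 𝒜 m ∧ t ∉ x.asHomogeneousIdeal.toIdeal := by
  classical
  by_contra! H
  refine x.not_irrelevant_le fun z hz ↦ ?_
  rw [← DirectSum.sum_support_decompose 𝒜 z]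
  exact x.1.toIdeal.sum_mem fun k hk ↦
    H _ k (Nat.pos_of_ne_zero (by rintro rfl; aesop)) (SetLike.coe_mem _)

/-- The sections of the twisting sheaf `𝒪(d)` over `U`: the functions `s` with `s x` in the
localization at `x` that are locally fractions of degree `d`. For `d = 0` this is the usual
description of the structure sheaf of `Proj`. -/
def twistSections (d : ℤ) (U : (Opens (ProjectiveSpectrum.top 𝒜))ᵒᵖ) :
    Submodule ((ProjectiveSpectrum.Proj.structureSheaf 𝒜).1.obj U)
      (∀ x : U.unop, LocAt 𝒜 x.1) where
  carrier := {s | (twistPredicate 𝒜 d).pred s}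
  zero_mem' := fun x => by
    obtain ⟨t, m, hm, ht, hx⟩ := exists_notMem 𝒜 x.1
    refine ⟨U.unop ⊓ ProjectiveSpectrum.basicOpen 𝒜 t, ⟨x.2, hx⟩, homOfLE inf_le_left,
      (m * d.natAbs + d).toNat, m * d.natAbs, 0, t ^ d.natAbs, ?_, zero_mem _, ?_, ?_, ?_⟩
    · have h1 : (1 : ℤ) ≤ m := by exact_mod_cast hm
      have h2 : -d ≤ (d.natAbs : ℤ) := by omega
      rw [Int.toNat_of_nonneg]
      · push_cast; ring
      · nlinarith [Int.natCast_nonneg d.natAbs]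
    · have := SetLike.pow_mem_graded d.natAbs ht
      rwa [smul_eq_mul, mul_comm] at this
    · intro y hy
      exact y.2.2 (y.1.isPrime.mem_of_pow_mem _ hy)
    · intro y
      exact (Localization.mk_zero _).symm
  add_mem' := fun {p q} hp hq x => by
    obtain ⟨V, hxV, iV, m, n, a, t, h, ha, ht, hn, hf⟩ := hp x
    obtain ⟨W, hxW, iW, m', n', a', t', h', ha', ht', hn', hf'⟩ := hq x
    refine ⟨V ⊓ W, ⟨hxV, hxW⟩, homOfLE (inf_le_left.trans iV.le), m + n', n + n',
      a * t' + t * a', t * t', by push_cast; rw [h]; ring, ?_,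
      SetLike.mul_mem_graded ht ht', ?_, ?_⟩
    · refine add_mem (SetLike.mul_mem_graded ha ht') ?_
      have e : m + n' = n + m' := by omega
      rw [e]
      exact SetLike.mul_mem_graded ht ha'
    · intro y
      exact fun hm => (y.1.isPrime.mem_or_mem hm).elim (hn ⟨y.1, y.2.1⟩) (hn' ⟨y.1, y.2.2⟩)
    · intro y
      have e1 := hf ⟨y.1, y.2.1⟩
      have e2 := hf' ⟨y.1, y.2.2⟩
      refine (congrArg₂ (· + ·) e1 e2).trans ?_
      refine (Localization.add_mk _ _ _ _).trans ?_
      refine congrArg₂ Localization.mk ?_ rfl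
      simp only []
      ring
  smul_mem' := fun r s hs x => by
    obtain ⟨V, hxV, iV, m, ⟨a, ha⟩, ⟨t, ht⟩, hn, hf⟩ := r.2 x
    obtain ⟨W, hxW, iW, m', n', a', t', h', ha', ht', hn', hf'⟩ := hs x
    refine ⟨V ⊓ W, ⟨hxV, hxW⟩, homOfLE (inf_le_left.trans iV.le), m + m', m + n',
      a * a', t * t', by push_cast; rw [h']; ring, SetLike.mul_mem_graded ha ha',
      SetLike.mul_mem_graded ht ht', ?_, ?_⟩
    · intro y
      exact fun hm => (y.1.isPrime.mem_or_mem hm).elim (hn ⟨y.1, y.2.1⟩) (hn' ⟨y.1, y.2.2⟩)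
    · intro y
      have e1 := congrArg HomogeneousLocalization.val (hf ⟨y.1, y.2.1⟩)
      have e2 := hf' ⟨y.1, y.2.2⟩
      refine (congrArg₂ (· * ·) e1 e2).trans ?_
      exact Localization.mk_mul _ _ _ _

/-- The twisting sheaf as a presheaf of abelian groups, with restriction of functions. -/
def twistPresheafAb (d : ℤ) : (Opens (ProjectiveSpectrum.top 𝒜))ᵒᵖ ⥤ Ab.{u} where
  obj U := AddCommGrpCat.of (twistSections 𝒜 d U)
  map i := AddCommGrpCat.ofHom
    { toFun := fun s => ⟨fun x => s.1 (i.unop x), (twistPredicate 𝒜 d).res i.unop s.1 s.2⟩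
      map_zero' := rfl
      map_add' := fun _ _ => rfl }

instance twistModule (d : ℤ) (U : (Opens (Proj 𝒜))ᵒᵖ) :
    Module ((Proj 𝒜).ringCatSheaf.obj.obj U) ((twistPresheafAb 𝒜 d).obj U) :=
  inferInstanceAs (Module ((ProjectiveSpectrum.Proj.structureSheaf 𝒜).1.obj U)
    (twistSections 𝒜 d U))

/-- Serre's twisting sheaf `𝒪(d)` on `Proj 𝒜`. -/
def twist (d : ℤ) : (Proj 𝒜).Modules where
  val := PresheafOfModules.ofPresheaf (R := (Proj 𝒜).ringCatSheaf.obj) (twistPresheafAb 𝒜 d)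
    (fun _ _ _ _ _ => rfl)
  isSheaf := by
    refine (TopCat.Presheaf.isSheaf_iff_isSheaf_comp (forget Ab.{u}) (X := ProjectiveSpectrum.top 𝒜)
      (twistPresheafAb 𝒜 d)).mpr ?_
    exact TopCat.Presheaf.isSheaf_of_iso
      (NatIso.ofComponents (fun _ => Iso.refl _) (by intros; rfl))
      (TopCat.subsheafToTypes (twistPredicate 𝒜 d)).property

end Twist

section Bundles

variable {X : Scheme.{u}}

/-- Restriction of a section. -/
def resSection {M : X.Modules} {U V : X.Opens} (h : V ≤ U) (s : Γ(M, U)) : Γ(M, V) :=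
  M.presheaf.map (homOfLE h).op s

/-- `M` is a vector bundle of rank `r`: near every point there are `r` sections that form a basis of
the sections of `M` over each smaller open set, i.e. `M` restricted to `U` is isomorphic to `𝒪ʳ`. -/
def IsVectorBundle (r : ℕ) (M : X.Modules) : Prop :=
  ∀ x : X, ∃ U : X.Opens, x ∈ U ∧ ∃ e : Fin r → Γ(M, U),
    ∀ (V : X.Opens) (hV : V ≤ U), Function.Bijective
      (fun c : Fin r → Γ(X, V) => ∑ i, c i • resSection hV (e i))


/-- The map on exterior powers induced by a semilinear map, `v₁ ∧ ⋯ ∧ vᵣ ↦ f v₁ ∧ ⋯ ∧ f vᵣ`. -/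
def exteriorSemilinear {R S M N : Type*} [CommRing R] [CommRing S] [AddCommGroup M]
    [AddCommGroup N] [Module R M] [Module S N] {φ : R →+* S} (f : M →ₛₗ[φ] N) (r : ℕ) :
    (⋀[R]^r M) →ₛₗ[φ] (⋀[S]^r N) :=
  letI : Module R (⋀[S]^r N) := Module.compHom _ φ
  let alt : M [⋀^Fin r]→ₗ[R] (⋀[S]^r N) :=
    { toFun := fun v => exteriorPower.ιMulti S r (fun i => f (v i))
      map_update_add' := fun {inst} v i x y => by
        cases Subsingleton.elim inst (instDecidableEqFin r)
        simp only [Function.apply_update (fun _ => f), map_add, AlternatingMap.map_update_add]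
      map_update_smul' := fun {inst} v i c x => by
        cases Subsingleton.elim inst (instDecidableEqFin r)
        simp only [Function.apply_update (fun _ => f), map_smulₛₗ, AlternatingMap.map_update_smul]
        rfl
      map_eq_zero_of_eq' := fun v i j h hij =>
        (exteriorPower.ιMulti S r).map_eq_zero_of_eq _ (congrArg f h) hij }
  { toFun := exteriorPower.alternatingMapLinearEquiv alt
    map_add' := map_add _
    map_smul' := map_smul _ }

theorem exteriorSemilinear_ιMulti {R S M N : Type*} [CommRing R] [CommRing S] [AddCommGroup M]
    [AddCommGroup N] [Module R M] [Module S N] {φ : R →+* S} (f : M →ₛₗ[φ] N) (r : ℕ)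
    (v : Fin r → M) :
    exteriorSemilinear f r (exteriorPower.ιMulti R r v) =
      exteriorPower.ιMulti S r (fun i => f (v i)) := by
  let _ : Module R (⋀[S]^r N) := Module.compHom _ φ
  exact exteriorPower.alternatingMapLinearEquiv_apply_ιMulti _ _

theorem exteriorSemilinear_id {R M : Type*} [CommRing R] [AddCommGroup M] [Module R M]
    {φ : R →+* R} (hφ : ∀ c, φ c = c) (f : M →ₛₗ[φ] M) (hf : ∀ x, f x = x) (r : ℕ)
    (y : ⋀[R]^r M) : exteriorSemilinear f r y = y := by
  have hy : y ∈ Submodule.span R (Set.range (exteriorPower.ιMulti R r (M := M))) := by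
    rw [exteriorPower.ιMulti_span]; trivial
  induction hy using Submodule.span_induction with
  | mem x h =>
    obtain ⟨v, rfl⟩ := h
    rw [exteriorSemilinear_ιMulti]
    simp only [hf]
  | zero => exact map_zero _
  | add x y _ _ hx hy => rw [map_add, hx, hy]
  | smul c x _ hx => rw [map_smulₛₗ, hx, hφ]

theorem exteriorSemilinear_comp {R S T M N P : Type*} [CommRing R] [CommRing S] [CommRing T]
    [AddCommGroup M] [AddCommGroup N] [AddCommGroup P] [Module R M] [Module S N] [Module T P]
    {φ : R →+* S} {ψ : S →+* T} {χ : R →+* T} (hχ : ∀ c, χ c = ψ (φ c))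
    (f : M →ₛₗ[φ] N) (g : N →ₛₗ[ψ] P) (h : M →ₛₗ[χ] P) (hh : ∀ x, h x = g (f x)) (r : ℕ)
    (y : ⋀[R]^r M) :
    exteriorSemilinear h r y = exteriorSemilinear g r (exteriorSemilinear f r y) := by
  have hy : y ∈ Submodule.span R (Set.range (exteriorPower.ιMulti R r (M := M))) := by
    rw [exteriorPower.ιMulti_span]; trivial
  induction hy using Submodule.span_induction with
  | mem x h =>
    obtain ⟨v, rfl⟩ := h
    simp only [exteriorSemilinear_ιMulti, hh]
  | zero => simp only [map_zero]
  | add x y _ _ hx hy => simp only [map_add, hx, hy]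
  | smul c x _ hx => simp only [map_smulₛₗ, hx, hχ]

/-- The restriction maps of `M`, as semilinear maps. -/
def restrictSemilinear (M : X.Modules) {U V : X.Opens} (i : V ⟶ U) :
    Γ(M, U) →ₛₗ[(X.presheaf.map i.op).hom] Γ(M, V) where
  toFun := M.presheaf.map i.op
  map_add' := map_add _
  map_smul' r x := M.map_smul i r x

/-- The presheaf `U ↦ ⋀ʳ Γ(M, U)`. -/
def exteriorPresheafAb (M : X.Modules) (r : ℕ) : X.Opensᵒᵖ ⥤ Ab.{u} where
  obj U := AddCommGrpCat.of (⋀[Γ(X, U.unop)]^r Γ(M, U.unop))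
  map i := AddCommGrpCat.ofHom (exteriorSemilinear (restrictSemilinear M i.unop) r).toAddMonoidHom
  map_id U := by
    ext y
    exact congrArg Subtype.val <| exteriorSemilinear_id (φ := (X.presheaf.map (𝟙 U.unop).op).hom)
      (fun c => ConcreteCategory.congr_hom (X.presheaf.map_id U) c)
      (restrictSemilinear M (𝟙 U.unop))
      (fun x => ConcreteCategory.congr_hom (M.presheaf.map_id U) x) r y
  map_comp {U V W} i j := by
    ext y
    exact congrArg Subtype.val <| exteriorSemilinear_comp
      (φ := (X.presheaf.map i.unop.op).hom) (ψ := (X.presheaf.map j.unop.op).hom)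
      (χ := (X.presheaf.map (j.unop ≫ i.unop).op).hom)
      (fun c => ConcreteCategory.congr_hom (X.presheaf.map_comp i j) c)
      (restrictSemilinear M i.unop) (restrictSemilinear M j.unop)
      (restrictSemilinear M (j.unop ≫ i.unop))
      (fun x => ConcreteCategory.congr_hom (M.presheaf.map_comp i j) x) r y

instance exteriorModule (M : X.Modules) (r : ℕ) (U : X.Opensᵒᵖ) :
    Module (X.ringCatSheaf.obj.obj U) ((exteriorPresheafAb M r).obj U) :=
  inferInstanceAs (Module Γ(X, U.unop) (⋀[Γ(X, U.unop)]^r Γ(M, U.unop)))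

/-- The exterior power `⋀ʳ M`: the sheaf associated with the presheaf `U ↦ ⋀ʳ Γ(M, U)`. -/
def exteriorPowerSheaf (M : X.Modules) (r : ℕ) : X.Modules :=
  (PresheafOfModules.sheafification (𝟙 X.ringCatSheaf.obj)).obj
    (PresheafOfModules.ofPresheaf (R := X.ringCatSheaf.obj) (exteriorPresheafAb M r)
      (fun _ _ i c y => (exteriorSemilinear (restrictSemilinear M i.unop) r).map_smulₛₗ c y))

end Bundles

section ProjectiveThreeSpace

variable (k : Type u) [Field k]

/-- The grading of `k[X₀, X₁, X₂, X₃]` by degree. -/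
instance gradedPolynomialRing : GradedAlgebra (MvPolynomial.homogeneousSubmodule (Fin 4) k) :=
  MvPolynomial.gradedAlgebra

/-- Projective three-space `ℙ³ = Proj k[X₀, X₁, X₂, X₃]`. -/
abbrev P3 : Scheme.{u} := Proj (MvPolynomial.homogeneousSubmodule (Fin 4) k)

/-- The line bundle `𝒪(d)` on `ℙ³`. -/
abbrev O (d : ℤ) : (P3 k).Modules := twist (MvPolynomial.homogeneousSubmodule (Fin 4) k) d

variable {k}

/-- `L` is an invertible sheaf of degree `d` on `ℙ³`, i.e. `L ≅ 𝒪(d)`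
(every invertible sheaf on `ℙ³` is isomorphic to `𝒪(d)` for exactly one integer `d`). -/
def IsInvertibleOfDegree (L : (P3 k).Modules) (d : ℤ) : Prop := Nonempty (L ≅ O k d)

/-- The first Chern class of the rank `r` vector bundle `E` on `ℙ³` is the integer `c`, i.e. its
determinant line bundle `⋀ʳ E` has degree `c`. -/
def HasFirstChernClass (r : ℕ) (E : (P3 k).Modules) (c : ℤ) : Prop :=
  IsInvertibleOfDegree (exteriorPowerSheaf E r) c

/-- A rank 2 vector bundle `E` on `ℙ³` is stable if `c₁(L) < c₁(E) / 2` for every invertible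
subsheaf `L` of `E`. -/
def IsStableRankTwo (E : (P3 k).Modules) : Prop :=
  IsVectorBundle 2 E ∧ ∀ c : ℤ, HasFirstChernClass 2 E c →
    ∀ (L : (P3 k).Modules) (d : ℤ) (i : L ⟶ E), IsInvertibleOfDegree L d → Mono i → 2 * d < c

/-- `E` is the cohomology `ker β / im α` of a monad `C ⟶ B ⟶ A`: a complex in which the first
map `α` is injective and the second map `β` is surjective. -/
def IsMonadCohomology (C B A E : (P3 k).Modules) : Prop :=
  ∃ (α : C ⟶ B) (β : B ⟶ A) (w : α ≫ β = 0), Mono α ∧ Epi β ∧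
    Nonempty (E ≅ (ShortComplex.mk α β w).homology)

/-- The direct sum `F^{⊕ n}` of `n` copies of `F`. -/
def copies (F : (P3 k).Modules) (n : ℕ) : (P3 k).Modules :=
  haveI : Limits.HasFiniteBiproducts (P3 k).Modules := Abelian.hasFiniteBiproducts
  Limits.biproduct (fun _ : Fin n => F)

end ProjectiveThreeSpace

end HorrocksMonads

end

/-! The two summands $\mathcal O(b)$ map to $\mathcal O(a_2)$ by forms $f,g$ of degree $a_2-b$. The
Koszul syzygy $(g,-f)$ is a map $\mathcal O(2b-a_2)\to\mathcal O(b)^{\oplus 2}$ killed by this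
component of $\beta$; if $f$ or $g$ is zero, a copy of $\mathcal O(b)$ serves instead. The component
into $\mathcal O(a_1)^{\oplus g}$ vanishes because $b>a_1$. So some $\mathcal O(d)$ with $d\ge 0$
maps nontrivially to $\ker\beta$. The left term of the monad has only negative twists, so this map
does not factor through $\alpha$ and stays nonzero in $\mathcal E$. A nonzero map from a line bundle
to a vector bundle is injective, hence $\mathcal O(d)\subset\mathcal E$ with $2d\ge 0\ge
c_1(\mathcal E)$, contrary to stability.

The rank and summands of $B$ play no role. The carrying lemmas are `eq_zero_or_eq_mulHom` (maps of
twisting sheaves are forms), `mono_of_ne_zero`, `exists_relation` and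
`exists_mono_of_isMonadCohomology`. The first two are proved by comparing sections inside the
fraction field of $k[X_0,\dots,X_3]$. -/

noncomputable section

namespace HorrocksMonads

universe u

/-! ### Homogeneous factors, and rational functions without poles on $\mathbb P^3$. -/

section Algebra

open MvPolynomial

variable {k : Type u} [Field k]

/-- The algebra map `Xᵢ ↦ Xᵢ T`, which records degrees as powers of `T`. -/
def degreeMarking {σ R : Type*} [CommRing R] :
    MvPolynomial σ R →ₐ[R] Polynomial (MvPolynomial σ R) :=
  aeval fun i => Polynomial.C (X i) * Polynomial.X

theorem degreeMarking_monomial {σ R : Type*} [CommRing R] (v : σ →₀ ℕ) (c : R) :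
    degreeMarking (monomial v c) = Polynomial.C (monomial v c) * Polynomial.X ^ v.degree := by
  rw [degreeMarking, aeval_monomial, monomial_eq]
  simp only [Finsupp.prod, mul_pow, Finset.prod_mul_distrib, Finset.prod_pow_eq_pow_sum,
    Polynomial.C_mul, map_prod, Polynomial.C_pow, ← mul_assoc, Finsupp.degree]
  rfl

/-- This makes homogeneity visible as being a monomial in $T$, so that one-variable degree arguments
apply. -/
theorem coeff_degreeMarking {σ R : Type*} [CommRing R] (n : ℕ) (f : MvPolynomial σ R) :
    (degreeMarking f).coeff n = homogeneousComponent n f := by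
  induction f using MvPolynomial.induction_on' with
  | monomial v c =>
    rw [degreeMarking_monomial, Polynomial.coeff_C_mul_X_pow]
    split_ifs with h
    · rw [homogeneousComponent_of_mem (isHomogeneous_monomial c h.symm), if_pos rfl]
    · rw [homogeneousComponent_of_mem (isHomogeneous_monomial c rfl), if_neg h]
  | add p q hp hq => rw [map_add, Polynomial.coeff_add, hp, hq, map_add]

theorem degreeMarking_of_isHomogeneous {σ R : Type*} [CommRing R] {n : ℕ} {f : MvPolynomial σ R}
    (hf : f.IsHomogeneous n) : degreeMarking f = Polynomial.C f * Polynomial.X ^ n := by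
  ext1 m
  rw [coeff_degreeMarking, Polynomial.coeff_C_mul_X_pow, homogeneousComponent_of_mem hf]

theorem degreeMarking_ne_zero {σ R : Type*} [CommRing R] {f : MvPolynomial σ R} (hf : f ≠ 0) :
    degreeMarking f ≠ 0 := by
  intro h
  apply hf
  rw [← sum_homogeneousComponent f]
  refine Finset.sum_eq_zero fun i _ => ?_
  rw [← coeff_degreeMarking, h, Polynomial.coeff_zero]

/-- Over a domain, the factors of a nonzero homogeneous polynomial are homogeneous. -/
theorem exists_isHomogeneous_of_mul {σ R : Type*} [CommRing R] [IsDomain R] {n : ℕ}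
    {f g : MvPolynomial σ R} (h : (f * g).IsHomogeneous n) (hfg : f * g ≠ 0) :
    ∃ i, f.IsHomogeneous i := by
  have hf := degreeMarking_ne_zero (left_ne_zero_of_mul hfg)
  have hg := degreeMarking_ne_zero (right_ne_zero_of_mul hfg)
  have h1 : degreeMarking f * degreeMarking g = Polynomial.C (f * g) * Polynomial.X ^ n := by
    rw [← map_mul, degreeMarking_of_isHomogeneous h]
  -- Over a domain both the degree and the lowest degree in $T$ are additive. They agree for the
  -- product, a monomial in $T$, so they agree for each factor.
  have h2 := congrArg Polynomial.natDegree h1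
  have h3 := congrArg Polynomial.natTrailingDegree h1
  rw [Polynomial.natDegree_mul hf hg, Polynomial.natDegree_C_mul_X_pow _ _ hfg] at h2
  rw [Polynomial.natTrailingDegree_mul hf hg, Polynomial.C_mul_X_pow_eq_monomial,
    Polynomial.natTrailingDegree_monomial hfg] at h3
  have h4 := Polynomial.natTrailingDegree_le_natDegree (degreeMarking f)
  have h5 := Polynomial.natTrailingDegree_le_natDegree (degreeMarking g)
  refine ⟨(degreeMarking f).natDegree, ?_⟩
  have h6 : homogeneousComponent (degreeMarking f).natDegree f = f := by
    refine Eq.trans (Eq.symm ?_) (sum_homogeneousComponent f)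
    by_cases hm : (degreeMarking f).natDegree ∈ Finset.range (f.totalDegree + 1)
    · refine Finset.sum_eq_single_of_mem _ hm fun j _ hj => ?_
      rw [← coeff_degreeMarking]
      rcases lt_or_gt_of_ne hj with hj | hj
      · exact Polynomial.coeff_eq_zero_of_lt_natTrailingDegree (by omega)
      · exact Polynomial.coeff_eq_zero_of_natDegree_lt hj
    · exfalso
      have : (degreeMarking f).leadingCoeff = 0 := by
        rw [Polynomial.leadingCoeff, coeff_degreeMarking]
        exact homogeneousComponent_eq_zero _ _ (by simpa using hm)
      exact hf (Polynomial.leadingCoeff_eq_zero.mp this)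
  have h7 := homogeneousComponent_isHomogeneous (degreeMarking f).natDegree f
  rwa [h6] at h7

/-- The zero ideal, as a point of `ℙ³`. -/
def bottomPt (k : Type u) [Field k] :
    ProjectiveSpectrum (homogeneousSubmodule (Fin 4) k) where
  asHomogeneousIdeal := ⊥
  isPrime := by
    rw [HomogeneousIdeal.toIdeal_bot]
    exact Ideal.isPrime_bot
  not_irrelevant_le h := by
    have h1 : (X 0 : MvPolynomial (Fin 4) k) ∈
        HomogeneousIdeal.irrelevant (homogeneousSubmodule (Fin 4) k) := by
      rw [HomogeneousIdeal.mem_irrelevant_iff, GradedRing.proj_apply,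
        DirectSum.decompose_of_mem_ne _ (isHomogeneous_X k 0) one_ne_zero]
    have h2 : (X 0 : MvPolynomial (Fin 4) k) ∈
        (⊥ : HomogeneousIdeal (homogeneousSubmodule (Fin 4) k)).toIdeal := h h1
    rw [HomogeneousIdeal.toIdeal_bot, Ideal.mem_bot] at h2
    exact X_ne_zero _ h2

theorem mem_bottomPt {f : MvPolynomial (Fin 4) k} :
    f ∈ (bottomPt k).asHomogeneousIdeal.toIdeal ↔ f = 0 := by
  change f ∈ (⊥ : HomogeneousIdeal (homogeneousSubmodule (Fin 4) k)).toIdeal ↔ _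
  rw [HomogeneousIdeal.toIdeal_bot, Ideal.mem_bot]

/-- The generic point of the surface `p = 0`. -/
def surfacePt {p : MvPolynomial (Fin 4) k} (hp : Prime p) {n : ℕ} (hn : p.IsHomogeneous n) :
    ProjectiveSpectrum (homogeneousSubmodule (Fin 4) k) where
  asHomogeneousIdeal := ⟨Ideal.span {p}, Ideal.homogeneous_span _ _ (by
    rintro x rfl
    exact ⟨n, hn⟩)⟩
  isPrime := (Ideal.span_singleton_prime hp.ne_zero).mpr hp
  not_irrelevant_le h := by
    have h1 (i : Fin 4) : p ∣ X i := by
      have : (X i : MvPolynomial (Fin 4) k) ∈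
          HomogeneousIdeal.irrelevant (homogeneousSubmodule (Fin 4) k) := by
        rw [HomogeneousIdeal.mem_irrelevant_iff, GradedRing.proj_apply,
          DirectSum.decompose_of_mem_ne _ (isHomogeneous_X k i) one_ne_zero]
      exact Ideal.mem_span_singleton.mp (h this)
    -- A prime dividing every variable would be associated to each of them, making $X_0$ divide
    -- $X_1$.
    have h2 (i : Fin 4) : Associated p (X i) :=
      hp.associated_of_dvd (X_prime (i := i)) (h1 i)
    have h3 : (X 0 : MvPolynomial (Fin 4) k) ∣ X 1 := ((h2 0).symm.trans (h2 1)).dvd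
    rw [X_dvd_X] at h3
    exact absurd h3 (by decide)

theorem mem_surfacePt {p : MvPolynomial (Fin 4) k} (hp : Prime p) {n : ℕ} (hn : p.IsHomogeneous n)
    (f : MvPolynomial (Fin 4) k) :
    f ∈ (surfacePt hp hn).asHomogeneousIdeal.toIdeal ↔ p ∣ f :=
  Ideal.mem_span_singleton

/-- A rational function that at every point of `ℙ³` is a quotient of homogeneous polynomials with
nonvanishing denominator is a polynomial. -/
theorem exists_polynomial_of_forall_point (q : FractionRing (MvPolynomial (Fin 4) k))
    (hq : ∀ y : ProjectiveSpectrum (homogeneousSubmodule (Fin 4) k),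
      ∃ (j : ℕ) (a t : MvPolynomial (Fin 4) k), t.IsHomogeneous j ∧
        t ∉ y.asHomogeneousIdeal.toIdeal ∧ q * algebraMap _ _ t = algebraMap _ _ a) :
    ∃ f : MvPolynomial (Fin 4) k, q = algebraMap _ _ f := by
  classical
  -- Choose a nonzero homogeneous denominator of least degree; it will turn out to be a unit. The
  -- generic point shows that one exists.
  have hex : ∃ j : ℕ, ∃ a t : MvPolynomial (Fin 4) k, t.IsHomogeneous j ∧ t ≠ 0 ∧
      q * algebraMap _ _ t = algebraMap _ _ a := by
    obtain ⟨j, a, t, h1, h2, h3⟩ := hq (bottomPt k)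
    exact ⟨j, a, t, h1, fun h => h2 (mem_bottomPt.mpr h), h3⟩
  obtain ⟨a, t, ht, ht0, hqt⟩ := Nat.find_spec hex
  have hmin := fun m => Nat.find_min hex (m := m)
  generalize Nat.find hex = n at *
  by_cases hu : IsUnit t
  · obtain ⟨v, rfl⟩ := hu
    refine ⟨a * ↑v⁻¹, ?_⟩
    rw [map_mul, ← hqt, mul_assoc, ← map_mul, Units.mul_inv, map_one, mul_one]
  · exfalso
    obtain ⟨p, hpi, t', rfl⟩ := WfDvdMonoid.exists_irreducible_factor hu ht0
    have hp := hpi.prime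
    obtain ⟨i, hi⟩ := exists_isHomogeneous_of_mul ht ht0
    obtain ⟨i', hi'⟩ := exists_isHomogeneous_of_mul (mul_comm p t' ▸ ht) (mul_comm p t' ▸ ht0)
    have hn : n = i + i' := ht.inj_right (hi.mul hi') ht0
    -- A factor of degree zero would be a constant, hence a unit; so cancelling $p$ strictly lowers
    -- the degree.
    have hi0 : i ≠ 0 := by
      rintro rfl
      obtain ⟨c, rfl⟩ : ∃ c, p = C c := ⟨_, (totalDegree_eq_zero_iff_eq_C).mp (by
        simpa using hi.totalDegree_le)⟩
      have hc : c ≠ 0 := by rintro rfl; exact hp.ne_zero (map_zero _)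
      exact hp.not_isUnit ((IsUnit.mk0 c hc).map C)
    -- At the generic point of $p=0$ there is a denominator $s$ prime to $p$. Cross-multiplying
    -- forces $p\mid a$, and cancelling $p$ contradicts minimality.
    obtain ⟨j, b, s, hs, hsp, hqs⟩ := hq (surfacePt hp hi)
    rw [mem_surfacePt] at hsp
    have h1 : a * s = b * (p * t') := by
      apply IsFractionRing.injective _ (FractionRing (MvPolynomial (Fin 4) k))
      rw [map_mul, map_mul, ← hqt, ← hqs]
      ring
    obtain ⟨a', rfl⟩ : p ∣ a := (hp.dvd_or_dvd (h1 ▸ ⟨b * t', by ring⟩)).resolve_right hsp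
    refine hmin i' (by omega) ⟨a', t', hi', right_ne_zero_of_mul ht0, ?_⟩
    have hp0 : algebraMap _ (FractionRing (MvPolynomial (Fin 4) k)) p ≠ 0 := by
      rw [Ne, IsFractionRing.to_map_eq_zero_iff]
      exact hp.ne_zero
    apply mul_left_cancel₀ hp0
    rw [← map_mul, ← hqt, map_mul]
    ring

end Algebra

/-! ### Sections of $\mathcal O(d)$ and regular functions as rational functions. -/

section Sections

open MvPolynomial

variable {k : Type u} [Field k]

/-- The local ring at a point, embedded into the field of rational functions on affine space. -/
def toRatFunc (y : ProjectiveSpectrum (homogeneousSubmodule (Fin 4) k)) :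
    LocAt (homogeneousSubmodule (Fin 4) k) y →+* FractionRing (MvPolynomial (Fin 4) k) :=
  IsLocalization.lift (M := y.asHomogeneousIdeal.toIdeal.primeCompl)
    (g := algebraMap (MvPolynomial (Fin 4) k) (FractionRing (MvPolynomial (Fin 4) k)))
    fun t => IsUnit.mk0 _ fun h => t.2 (by
      rw [IsFractionRing.to_map_eq_zero_iff] at h
      rw [h]
      exact zero_mem _)

theorem toRatFunc_algebraMap (y : ProjectiveSpectrum (homogeneousSubmodule (Fin 4) k))
    (f : MvPolynomial (Fin 4) k) :
    toRatFunc y (algebraMap _ _ f) = algebraMap _ _ f :=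
  IsLocalization.lift_eq _ _

theorem toRatFunc_mk (y : ProjectiveSpectrum (homogeneousSubmodule (Fin 4) k))
    (a : MvPolynomial (Fin 4) k) (t : y.asHomogeneousIdeal.toIdeal.primeCompl) :
    toRatFunc y (Localization.mk a t) * algebraMap _ _ (t : MvPolynomial (Fin 4) k) =
      algebraMap _ _ a := by
  rw [← toRatFunc_algebraMap y, ← map_mul, ← toRatFunc_algebraMap y]
  congr 1
  rw [Localization.mk_eq_mk']
  exact IsLocalization.mk'_spec _ _ _

theorem toRatFunc_injective (y : ProjectiveSpectrum (homogeneousSubmodule (Fin 4) k)) :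
    Function.Injective (toRatFunc y) := by
  refine (IsLocalization.lift_injective_iff _).mpr fun a b => ?_
  rw [(IsFractionRing.injective _ (FractionRing (MvPolynomial (Fin 4) k))).eq_iff]
  refine (IsLocalization.injective (M := y.asHomogeneousIdeal.toIdeal.primeCompl) _ ?_).eq_iff
  intro t ht
  exact mem_nonZeroDivisors_of_ne_zero fun h => ht (h ▸ zero_mem _)

/-- The generic point of `ℙ³`. -/
def genericPt (k : Type u) [Field k] : P3 k := bottomPt k

/-- The open set where a polynomial does not vanish. -/
def nonvanishing (t : MvPolynomial (Fin 4) k) : (P3 k).Opens :=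
  ProjectiveSpectrum.basicOpen (homogeneousSubmodule (Fin 4) k) t

theorem genericPt_mem_nonvanishing {t : MvPolynomial (Fin 4) k} :
    genericPt k ∈ nonvanishing t ↔ t ≠ 0 :=
  not_congr mem_bottomPt

theorem algebraMap_ne_zero {y : P3 k} {t : MvPolynomial (Fin 4) k} (ht : y ∈ nonvanishing t) :
    algebraMap _ (FractionRing (MvPolynomial (Fin 4) k)) t ≠ 0 := by
  rw [Ne, IsFractionRing.to_map_eq_zero_iff]
  rintro rfl
  exact ht (zero_mem _)

theorem mul_mem_nonvanishing {y : P3 k} {s t : MvPolynomial (Fin 4) k} (hs : y ∈ nonvanishing s)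
    (ht : y ∈ nonvanishing t) : y ∈ nonvanishing (s * t) :=
  fun h => ((show ProjectiveSpectrum (homogeneousSubmodule (Fin 4) k) from y).isPrime.mem_or_mem
    h).elim hs ht

theorem pow_mem_nonvanishing {y : P3 k} {t : MvPolynomial (Fin 4) k} (ht : y ∈ nonvanishing t)
    (n : ℕ) : y ∈ nonvanishing (t ^ n) :=
  fun h => ht ((show ProjectiveSpectrum (homogeneousSubmodule (Fin 4) k) from
    y).isPrime.mem_of_pow_mem _ h)

/-- A basic open set around $y$ is defined by a nonzero polynomial, which does not lie in the zero
ideal. -/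
theorem genericPt_mem {U : (P3 k).Opens} {y : P3 k} (hy : y ∈ U) : genericPt k ∈ U := by
  obtain ⟨_, ⟨f, rfl⟩, hf, hU⟩ :=
    (ProjectiveSpectrum.isTopologicalBasis_basic_opens
      (homogeneousSubmodule (Fin 4) k)).exists_subset_of_mem_open
      (a := (y : ProjectiveSpectrum (homogeneousSubmodule (Fin 4) k))) hy U.2
  refine hU ?_
  change genericPt k ∈ nonvanishing f
  rw [genericPt_mem_nonvanishing]
  rintro rfl
  exact hf (zero_mem _)

/-- The value of a section of `𝒪(d)` at a point, as a rational function. -/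
def twistVal {d : ℤ} {U : (P3 k).Opens} (s : Γ(O k d, U)) (y : P3 k) (hy : y ∈ U) :
    FractionRing (MvPolynomial (Fin 4) k) :=
  toRatFunc y ((show twistSections (homogeneousSubmodule (Fin 4) k) d (op U) from s).1 ⟨y, hy⟩)

/-- The value of a regular function at a point, as a rational function. -/
def regVal {U : (P3 k).Opens} (r : Γ(P3 k, U)) (y : P3 k) (hy : y ∈ U) :
    FractionRing (MvPolynomial (Fin 4) k) :=
  toRatFunc y ((show (ProjectiveSpectrum.Proj.structureSheaf
    (homogeneousSubmodule (Fin 4) k)).1.obj (op U) from r).1 ⟨y, hy⟩).val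

theorem twistVal_resSection {d : ℤ} {U V : (P3 k).Opens} (h : V ≤ U) (s : Γ(O k d, U)) (y : P3 k)
    (hy : y ∈ V) : twistVal (resSection h s) y hy = twistVal s y (h hy) := rfl

theorem twistVal_zero {d : ℤ} {U : (P3 k).Opens} (y : P3 k) (hy : y ∈ U) :
    twistVal (0 : Γ(O k d, U)) y hy = 0 := map_zero _

theorem twistVal_smul {d : ℤ} {U : (P3 k).Opens} (r : Γ(P3 k, U)) (s : Γ(O k d, U)) (y : P3 k)
    (hy : y ∈ U) : twistVal (r • s) y hy = regVal r y hy * twistVal s y hy := map_mul _ _ _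

theorem regVal_mul {U : (P3 k).Opens} (r s : Γ(P3 k, U)) (y : P3 k)
    (hy : y ∈ U) : regVal (r * s) y hy = regVal r y hy * regVal s y hy :=
  (congrArg _ (HomogeneousLocalization.val_mul _ _)).trans (map_mul _ _ _)

theorem regVal_zero {U : (P3 k).Opens} (y : P3 k)
    (hy : y ∈ U) : regVal (0 : Γ(P3 k, U)) y hy = 0 :=
  (congrArg _ HomogeneousLocalization.val_zero).trans (map_zero _)

theorem regVal_res {U V : (P3 k).Opens} (h : V ≤ U) (r : Γ(P3 k, U)) (y : P3 k)
    (hy : y ∈ V) : regVal ((P3 k).presheaf.map (homOfLE h).op r) y hy = regVal r y (h hy) := rfl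

/-- The neighbourhood on which the fraction represents $s$ also contains the generic point, so one
fraction serves both places. -/
theorem exists_fraction {d : ℤ} {U : (P3 k).Opens} (s : Γ(O k d, U)) (y : P3 k) (hy : y ∈ U) :
    ∃ (i j : ℕ) (a t : MvPolynomial (Fin 4) k), (i : ℤ) = j + d ∧ a.IsHomogeneous i ∧
      t.IsHomogeneous j ∧
      y ∈ nonvanishing t ∧
      twistVal s y hy * algebraMap _ _ t = algebraMap _ _ a ∧
      twistVal s (genericPt k) (genericPt_mem hy) * algebraMap _ _ t = algebraMap _ _ a := by
  obtain ⟨V, hyV, iV, i, j, a, t, h, ha, ht, hn, hf⟩ :=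
    (show twistSections (homogeneousSubmodule (Fin 4) k) d (op U) from s).2 ⟨y, hy⟩
  refine ⟨i, j, a, t, h, ha, ht, hn ⟨y, hyV⟩, ?_, ?_⟩
  · exact (congrArg (fun z => toRatFunc y z * _) (hf ⟨y, hyV⟩)).trans (toRatFunc_mk _ _ _)
  · exact (congrArg (fun z => toRatFunc _ z * _) (hf ⟨_, genericPt_mem hyV⟩)).trans
      (toRatFunc_mk _ _ _)

theorem twistVal_eq {d : ℤ} {U : (P3 k).Opens} (s : Γ(O k d, U)) (y : P3 k) (hy : y ∈ U) :
    twistVal s y hy = twistVal s (genericPt k) (genericPt_mem hy) := by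
  obtain ⟨i, j, a, t, -, -, -, ht, h1, h2⟩ := exists_fraction s y hy
  exact mul_right_cancel₀ (algebraMap_ne_zero ht) (h1.trans h2.symm)

/-- The value of a section is the same rational function at every point, by `twistVal_eq`. An open
set missing the generic point is empty, which is why the hypothesis may be conditional on `hy`. -/
theorem twistSection_ext {d : ℤ} {U : (P3 k).Opens} {s s' : Γ(O k d, U)}
    (h : ∀ hy : genericPt k ∈ U,
      twistVal s (genericPt k) hy = twistVal s' (genericPt k) hy) : s = s' := by
  apply Subtype.ext
  funext ⟨y, hy⟩
  apply toRatFunc_injective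
  exact (twistVal_eq s y hy).trans ((h _).trans (twistVal_eq s' y hy).symm)

/-- A regular function as a section of `𝒪(0)`. -/
def regToTwist {U : (P3 k).Opens} (r : Γ(P3 k, U)) : Γ(O k 0, U) :=
  show twistSections (homogeneousSubmodule (Fin 4) k) 0 (op U) from
  ⟨fun y => ((show (ProjectiveSpectrum.Proj.structureSheaf
    (homogeneousSubmodule (Fin 4) k)).1.obj (op U) from r).1 y).val, fun x => by
    obtain ⟨V, hxV, iV, m, ⟨a, ha⟩, ⟨t, ht⟩, hn, hf⟩ :=
      (show (ProjectiveSpectrum.Proj.structureSheaf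
        (homogeneousSubmodule (Fin 4) k)).1.obj (op U) from r).2 x
    exact ⟨V, hxV, iV, m, m, a, t, (add_zero _).symm, ha, ht, hn,
      fun y => congrArg HomogeneousLocalization.val (hf y)⟩⟩

theorem reg_ext {U : (P3 k).Opens} {r r' : Γ(P3 k, U)}
    (h : ∀ hy : genericPt k ∈ U,
      regVal r (genericPt k) hy = regVal r' (genericPt k) hy) : r = r' := by
  have h1 : regToTwist r = regToTwist r' := twistSection_ext h
  apply Subtype.ext
  funext y
  exact HomogeneousLocalization.val_injective _ (congrFun (congrArg Subtype.val h1) y)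

/-- The section `a / t` of `𝒪(d)` over an open set on which `t` does not vanish. -/
def fracSection {d : ℤ} (U : (P3 k).Opens) {i j : ℕ} {a t : MvPolynomial (Fin 4) k}
    (h : (i : ℤ) = j + d) (ha : a.IsHomogeneous i) (ht : t.IsHomogeneous j)
    (hU : U ≤ nonvanishing t) : Γ(O k d, U) :=
  show twistSections (homogeneousSubmodule (Fin 4) k) d (op U) from
  ⟨fun y => Localization.mk a ⟨t, hU y.2⟩,
    fun x => ⟨U, x.2, 𝟙 U, i, j, a, t, h, ha, ht, fun y => hU y.2, fun _ => rfl⟩⟩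

theorem twistVal_fracSection {d : ℤ} (U : (P3 k).Opens) {i j : ℕ} {a t : MvPolynomial (Fin 4) k}
    (h : (i : ℤ) = j + d) (ha : a.IsHomogeneous i) (ht : t.IsHomogeneous j)
    (hU : U ≤ nonvanishing t) (y : P3 k)
    (hy : y ∈ U) :
    twistVal (fracSection U h ha ht hU) y hy * algebraMap _ _ t = algebraMap _ _ a :=
  toRatFunc_mk _ _ _

/-- The regular function `a / t` on an open set on which `t` does not vanish. -/
def fracReg (U : (P3 k).Opens) {n : ℕ} {a t : MvPolynomial (Fin 4) k}
    (ha : a.IsHomogeneous n) (ht : t.IsHomogeneous n)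
    (hU : U ≤ nonvanishing t) : Γ(P3 k, U) :=
  show (ProjectiveSpectrum.Proj.structureSheaf (homogeneousSubmodule (Fin 4) k)).1.obj (op U) from
  ⟨fun y => HomogeneousLocalization.mk ⟨n, ⟨a, ha⟩, ⟨t, ht⟩, hU y.2⟩,
    fun x => ⟨U, x.2, 𝟙 U, n, ⟨a, ha⟩, ⟨t, ht⟩, fun y => hU y.2, fun _ => rfl⟩⟩

theorem regVal_fracReg (U : (P3 k).Opens) {n : ℕ} {a t : MvPolynomial (Fin 4) k}
    (ha : a.IsHomogeneous n) (ht : t.IsHomogeneous n)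
    (hU : U ≤ nonvanishing t) (y : P3 k)
    (hy : y ∈ U) :
    regVal (fracReg U ha ht hU) y hy * algebraMap _ _ t = algebraMap _ _ a :=
  toRatFunc_mk _ _ _

/-- Multiplication by a homogeneous polynomial, as a morphism of twisting sheaves. -/
def mulHom {d e : ℤ} {m : ℕ} {f : MvPolynomial (Fin 4) k} (hf : f.IsHomogeneous m)
    (h : e = d + m) : O k d ⟶ O k e where
  val := PresheafOfModules.homMk
    (M₁ := (O k d).val) (M₂ := (O k e).val)
    { app := fun U => AddCommGrpCat.ofHom
        { toFun := fun s => (show twistSections (homogeneousSubmodule (Fin 4) k) e U from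
            ⟨fun y => algebraMap _ _ f *
              (show twistSections (homogeneousSubmodule (Fin 4) k) d U from s).1 y, fun x => by
              obtain ⟨V, hxV, iV, i, j, a, t, h', ha, ht, hn, hs⟩ :=
                (show twistSections (homogeneousSubmodule (Fin 4) k) d U from s).2 x
              refine ⟨V, hxV, iV, m + i, j, f * a, t, by push_cast; rw [h', h]; ring,
                hf.mul ha, ht, hn, fun y => ?_⟩
              refine (congrArg (algebraMap _ _ f * ·) (hs y)).trans ?_
              rw [← Localization.mk_one_eq_algebraMap]
              refine (Localization.mk_mul _ _ _ _).trans ?_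
              rw [one_mul]⟩)
          map_zero' := Subtype.ext (funext fun _ => mul_zero _)
          map_add' := fun _ _ => Subtype.ext (funext fun _ => mul_add _ _ _) }
      naturality := fun _ _ _ => rfl }
    (fun _ _ _ => Subtype.ext (funext fun _ => mul_left_comm _ _ _))

theorem twistVal_mulHom {d e : ℤ} {m : ℕ} {f : MvPolynomial (Fin 4) k} (hf : f.IsHomogeneous m)
    (h : e = d + m) (U : (P3 k).Opens) (s : Γ(O k d, U)) (y : P3 k) (hy : y ∈ U) :
    twistVal ((mulHom hf h).app U s) y hy = algebraMap _ _ f * twistVal s y hy :=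
  (map_mul _ _ _).trans (congrArg (· * _) (toRatFunc_algebraMap _ _))

end Sections

/-! ### Restriction of sections and locality of vanishing. -/

section Restriction

variable {X : Scheme.{u}}

theorem app_resSection {M N : X.Modules} (φ : M ⟶ N) {U V : X.Opens} (h : V ≤ U) (s : Γ(M, U)) :
    φ.app V (resSection h s) = resSection h (φ.app U s) :=
  ConcreteCategory.congr_hom (φ.mapPresheaf.naturality (homOfLE h).op) s

theorem resSection_smul {M : X.Modules} {U V : X.Opens} (h : V ≤ U) (r : Γ(X, U)) (s : Γ(M, U)) :
    resSection h (r • s) = X.presheaf.map (homOfLE h).op r • resSection h s :=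
  M.map_smul (homOfLE h) r s

theorem resSection_resSection {M : X.Modules} {U V W : X.Opens} (h : V ≤ U) (h' : W ≤ V)
    (s : Γ(M, U)) : resSection h' (resSection h s) = resSection (h'.trans h) s :=
  (ConcreteCategory.congr_hom (M.presheaf.map_comp (homOfLE h).op (homOfLE h').op) s).symm

theorem resSection_zero {M : X.Modules} {U V : X.Opens} (h : V ≤ U) :
    resSection h (0 : Γ(M, U)) = 0 := map_zero _

theorem resSection_sum {M : X.Modules} {U V : X.Opens} (h : V ≤ U) {ι : Type*} (t : Finset ι)
    (s : ι → Γ(M, U)) : resSection h (∑ i ∈ t, s i) = ∑ i ∈ t, resSection h (s i) := map_sum _ _ _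

/-- A section that vanishes near every point vanishes. -/
theorem section_eq_zero {M : X.Modules} {U : X.Opens} (s : Γ(M, U))
    (h : ∀ x ∈ U, ∃ (V : X.Opens) (hV : V ≤ U), x ∈ V ∧ resSection hV s = 0) : s = 0 := by
  choose V hV hx hs using h
  refine TopCat.Sheaf.eq_of_locally_eq' (F := (⟨M.presheaf, M.isSheaf⟩ : TopCat.Sheaf Ab X))
    (fun x : U => V x.1 x.2) U (fun x => homOfLE (hV x.1 x.2)) ?_ s 0 fun x => ?_
  · intro x hxU
    exact Opens.mem_iSup.mpr ⟨⟨x, hxU⟩, hx x hxU⟩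
  · exact (hs x.1 x.2).trans (resSection_zero (hV x.1 x.2)).symm

end Restriction

/-! ### Proportional sections, torsion-freeness and injectivity. -/

section Morphisms

open MvPolynomial

variable {k : Type u} [Field k]

/-- $\mathcal O(d)$ has rank one. For $s=a/t$ and $s'=a'/t'$ near the generic point, take
$r=ta'/X_0^N$ and $r'=t'a/X_0^N$; the power $N=j+i'=j'+i$ makes both of degree zero. -/
theorem exists_proportional {d : ℤ} {U : (P3 k).Opens} (hU : genericPt k ∈ U)
    (s s' : Γ(O k d, U)) :
    ∃ (V : (P3 k).Opens) (hV : V ≤ U) (_ : genericPt k ∈ V) (r r' : Γ(P3 k, V)),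
      r • resSection hV s = r' • resSection hV s' ∧ (s' ≠ 0 → r ≠ 0) := by
  obtain ⟨i, j, a, t, h, ha, ht, htn, hs, -⟩ := exists_fraction s (genericPt k) hU
  obtain ⟨i', j', a', t', h', ha', ht', htn', hs', -⟩ := exists_fraction s' (genericPt k) hU
  have hX : genericPt k ∈ nonvanishing ((X 0 : MvPolynomial (Fin 4) k) ^ (j + i')) :=
    genericPt_mem_nonvanishing.mpr (pow_ne_zero _ (X_ne_zero _))
  have hXh : ((X 0 : MvPolynomial (Fin 4) k) ^ (j + i')).IsHomogeneous (j + i') :=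
    isHomogeneous_X_pow _ _
  let V : (P3 k).Opens := U ⊓ nonvanishing ((X 0 : MvPolynomial (Fin 4) k) ^ (j + i'))
  have hV : genericPt k ∈ V := ⟨hU, hX⟩
  have e : j' + i = j + i' := by omega
  have hh : (t' * a).IsHomogeneous (j + i') := e ▸ ht'.mul ha
  have h1 := regVal_fracReg V (ht.mul ha') hXh inf_le_right _ hV
  have h2 := regVal_fracReg V hh hXh inf_le_right _ hV
  refine ⟨V, inf_le_left, hV, fracReg V (ht.mul ha') hXh inf_le_right,
    fracReg V hh hXh inf_le_right, ?_, ?_⟩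
  · refine twistSection_ext fun _ => ?_
    rw [twistVal_smul, twistVal_smul, twistVal_resSection, twistVal_resSection]
    apply mul_right_cancel₀ (algebraMap_ne_zero hX)
    rw [mul_right_comm, h1, mul_right_comm, h2, map_mul, map_mul, ← hs, ← hs']
    ring
  · intro hs0 hr
    rw [hr, regVal_zero, zero_mul] at h1
    have h3 := (IsFractionRing.to_map_eq_zero_iff.mp h1.symm)
    rcases mul_eq_zero.mp h3 with h3 | h3
    · exact genericPt_mem_nonvanishing.mp htn h3
    · refine hs0 (twistSection_ext fun _ => ?_)
      rw [h3, map_zero] at hs'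
      rw [twistVal_zero]
      exact (mul_eq_zero.mp hs').resolve_right (algebraMap_ne_zero htn')

theorem regVal_ne_zero {U : (P3 k).Opens} {r : Γ(P3 k, U)} (hr : r ≠ 0)
    (hU : genericPt k ∈ U) : regVal r (genericPt k) hU ≠ 0 :=
  fun h => hr (reg_ext fun hy => h.trans (regVal_zero _ hy).symm)

/-- Vector bundles are torsion free. -/
theorem IsVectorBundle.eq_zero_of_smul_eq_zero {n : ℕ} {E : (P3 k).Modules}
    (hE : IsVectorBundle n E) {U V : (P3 k).Opens} (hV : V ≤ U) (hη : genericPt k ∈ V)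
    (w : Γ(E, U)) (r : Γ(P3 k, V)) (hr : r ≠ 0) (h : r • resSection hV w = 0) : w = 0 := by
  refine section_eq_zero w fun x hx => ?_
  obtain ⟨W, hxW, e, he⟩ := hE x
  refine ⟨U ⊓ W, inf_le_left, ⟨hx, hxW⟩, ?_⟩
  obtain ⟨c, hc⟩ := (he (U ⊓ W) inf_le_right).2 (resSection inf_le_left w)
  have hgW := genericPt_mem hxW
  have hc0 : c = 0 := by
    -- On $V\cap W$ the products $rc_i$ are the coordinates of $rw=0$, hence zero. At the generic
    -- point $r$ is a nonzero element of a field, so each $c_i$ vanishes.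
    have hVW : V ⊓ W ≤ U ⊓ W := inf_le_inf_right _ hV
    have h1 := (he (V ⊓ W) inf_le_right).1
      (a₁ := fun i => (P3 k).presheaf.map (homOfLE (inf_le_left : V ⊓ W ≤ V)).op r *
        (P3 k).presheaf.map (homOfLE hVW).op (c i)) (a₂ := 0) (by
      have h2 := congrArg (resSection hVW) hc
      have h3 := congrArg (resSection (inf_le_left : V ⊓ W ≤ V)) h
      simp only [resSection_sum, resSection_smul, resSection_resSection, resSection_zero]
        at h2 h3
      simp only [mul_smul, ← Finset.smul_sum, h2, h3, Pi.zero_apply, zero_smul,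
        Finset.sum_const_zero])
    funext i
    refine reg_ext fun hy => ?_
    have h4 := congrArg (fun z => regVal z (genericPt k)
      (show genericPt k ∈ V ⊓ W from ⟨hη, hgW⟩)) (congrFun h1 i)
    simp only [regVal_mul, regVal_res, Pi.zero_apply, regVal_zero] at h4
    rw [Pi.zero_apply, regVal_zero]
    exact (mul_eq_zero.mp h4).resolve_left (regVal_ne_zero hr hη)
  rw [← hc, hc0]
  simp only [Pi.zero_apply, zero_smul, Finset.sum_const_zero]

/-- A nonzero morphism from a line bundle to a vector bundle is injective. -/
theorem mono_of_ne_zero {n : ℕ} {E : (P3 k).Modules} (hE : IsVectorBundle n E) {d : ℤ}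
    (φ : O k d ⟶ E) (hφ : φ ≠ 0) : Mono φ := by
  have key : ∀ (U : (P3 k).Opens) (s : Γ(O k d, U)), φ.app U s = 0 → s = 0 := by
    intro U s hs
    by_contra hs0
    -- If a nonzero $s$ is killed, every other section satisfies $rs'=r's$ near the generic point
    -- with $r\ne 0$. Then $r\varphi(s')=0$, and torsion-freeness gives $\varphi(s')=0$, so
    -- $\varphi=0$.
    refine hφ (Scheme.Modules.hom_ext _ _ fun U' => ?_)
    ext s'
    change φ.app U' s' = 0
    by_cases hU' : genericPt k ∈ U'
    swap
    · rw [show s' = 0 from twistSection_ext fun h => absurd h hU', map_zero]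
    by_cases hU : genericPt k ∈ U
    swap
    · exact absurd (twistSection_ext fun h => absurd h hU) hs0
    obtain ⟨V, hV, hη, r, r', h1, h2⟩ := exists_proportional
      (U := U ⊓ U') ⟨hU, hU'⟩ (resSection inf_le_right s') (resSection inf_le_left s)
    refine hE.eq_zero_of_smul_eq_zero (hV.trans inf_le_right) hη _ r (h2 fun h => hs0 ?_) ?_
    · refine twistSection_ext fun hy => ?_
      have h3 := congrArg (fun z => twistVal z (genericPt k)
        (show genericPt k ∈ U ⊓ U' from ⟨hU, hU'⟩)) h
      simp only [twistVal_resSection, twistVal_zero] at h3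
      rw [h3, twistVal_zero]
    · have h3 := congrArg (φ.app V) h1
      rw [Scheme.Modules.Hom.app_smul, Scheme.Modules.Hom.app_smul, resSection_resSection,
        resSection_resSection, app_resSection, app_resSection, hs, resSection_zero,
        smul_zero] at h3
      exact h3
  refine ⟨fun {Z} g h hgh => Scheme.Modules.hom_ext _ _ fun U => ?_⟩
  ext z
  rw [← sub_eq_zero]
  refine key U _ ?_
  rw [map_sub, sub_eq_zero]
  exact ConcreteCategory.congr_hom (congrArg (fun ψ => Scheme.Modules.Hom.app ψ U) hgh) z

/-! ### Morphisms between twisting sheaves. -/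

/-- The generator `Xᵢᵈ` of `𝒪(d)` on the open set where `Xᵢ` does not vanish. -/
def generator (k : Type u) [Field k] (d : ℤ) (i : Fin 4) :
    Γ(O k d, nonvanishing (X i)) :=
  -- At least one of the truncated exponents is zero, so this is $X_i^d$ for either sign of $d$.
  fracSection (i := d.toNat) (j := (-d).toNat) (a := X i ^ d.toNat) (t := X i ^ (-d).toNat) _
    (by omega) (isHomogeneous_X_pow _ _) (isHomogeneous_X_pow _ _)
    fun _ hy => pow_mem_nonvanishing hy _

theorem genericPt_mem_nonvanishing_X (i : Fin 4) :
    genericPt k ∈ nonvanishing (X i : MvPolynomial (Fin 4) k) :=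
  genericPt_mem_nonvanishing.mpr (X_ne_zero i)

theorem twistVal_generator (d : ℤ) (i : Fin 4) (y : P3 k)
    (hy : y ∈ nonvanishing (X i)) :
    twistVal (generator k d i) y hy *
        algebraMap (MvPolynomial (Fin 4) k) _ (X i ^ (-d).toNat) =
      algebraMap (MvPolynomial (Fin 4) k) _ (X i ^ d.toNat) :=
  twistVal_fracSection _ _ _ _ _ _ _

theorem algebraMap_X_pow_ne_zero (i : Fin 4) (n : ℕ) :
    algebraMap (MvPolynomial (Fin 4) k) (FractionRing (MvPolynomial (Fin 4) k)) (X i ^ n) ≠ 0 := by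
  rw [Ne, IsFractionRing.to_map_eq_zero_iff]
  exact pow_ne_zero _ (X_ne_zero _)

theorem twistVal_generator_ne_zero (d : ℤ) (i : Fin 4) (y : P3 k)
    (hy : y ∈ nonvanishing (X i)) : twistVal (generator k d i) y hy ≠ 0 := by
  intro h
  have h1 := twistVal_generator d i y hy
  rw [h, zero_mul] at h1
  exact algebraMap_X_pow_ne_zero _ _ h1.symm

/-- A homogeneous polynomial of positive degree has no constant term, so a prime containing all the
variables would contain it, against `exists_notMem`. -/
theorem exists_mem_nonvanishing_X (y : P3 k) :
    ∃ i : Fin 4, y ∈ nonvanishing (X i : MvPolynomial (Fin 4) k) := by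
  by_contra h0
  have h (i : Fin 4) : (X i : MvPolynomial (Fin 4) k) ∈
      (show ProjectiveSpectrum (homogeneousSubmodule (Fin 4) k) from
        y).asHomogeneousIdeal.toIdeal := by_contra fun hi => h0 ⟨i, hi⟩
  obtain ⟨t, m, hm, ht, hty⟩ := exists_notMem (homogeneousSubmodule (Fin 4) k) y
  refine hty ?_
  have h1 : t ∈ Ideal.span (X '' (Set.univ : Set (Fin 4)) : Set (MvPolynomial (Fin 4) k)) := by
    rw [mem_ideal_span_X_image]
    intro v hv
    by_contra! h0
    have h2 : v = 0 := Finsupp.ext fun i => h0 i trivial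
    have h3 := ((mem_homogeneousSubmodule _ _).mp ht) (mem_support_iff.mp hv)
    rw [h2, map_zero] at h3
    omega
  refine Ideal.span_le.mpr ?_ h1
  rintro _ ⟨i, -, rfl⟩
  exact h i

/-- On the level of rational functions, a morphism of twisting sheaves is a multiplication. -/
theorem exists_ratio {d e : ℤ} (φ : O k d ⟶ O k e) :
    ∃ q : FractionRing (MvPolynomial (Fin 4) k), ∀ (U : (P3 k).Opens) (s : Γ(O k d, U))
      (y : P3 k) (hy : y ∈ U), twistVal (φ.app U s) y hy = q * twistVal s y hy := by
  have hg := genericPt_mem_nonvanishing_X (k := k) 0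
  have hg0 := twistVal_generator_ne_zero (k := k) d 0 _ hg
  refine ⟨twistVal (φ.app _ (generator k d 0)) (genericPt k) hg /
    twistVal (generator k d 0) (genericPt k) hg, fun U s y hy => ?_⟩
  rw [twistVal_eq, twistVal_eq s]
  have hU := genericPt_mem hy
  obtain ⟨V, hV, hη, r, r', h1, h2⟩ := exists_proportional
    (U := U ⊓ nonvanishing (X 0)) ⟨hU, hg⟩
    (resSection inf_le_left s) (resSection inf_le_right (generator k d 0))
  have hr := regVal_ne_zero (h2 fun h => hg0 (by
    have h3 := congrArg (fun z => twistVal z (genericPt k)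
      (show genericPt k ∈ U ⊓ nonvanishing (X 0) from ⟨hU, hg⟩)) h
    simpa only [twistVal_resSection, twistVal_zero] using h3)) hη
  have h3 := congrArg (fun z => twistVal (φ.app V z) (genericPt k) hη) h1
  have h4 := congrArg (fun z => twistVal z (genericPt k) hη) h1
  simp only [Scheme.Modules.Hom.app_smul, resSection_resSection, app_resSection, twistVal_smul,
    twistVal_resSection] at h3 h4
  rw [div_mul_eq_mul_div, eq_div_iff hg0]
  apply mul_left_cancel₀ hr
  -- The relation $rs=r'X_0^d$ and its image under $\varphi$ combine to eliminate $r'$.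
  linear_combination twistVal (generator k d 0) (genericPt k) hg * h3 -
    twistVal (φ.app _ (generator k d 0)) (genericPt k) hg * h4

/-- Every nonzero morphism `𝒪(d) ⟶ 𝒪(e)` is multiplication by a homogeneous polynomial. -/
theorem eq_zero_or_eq_mulHom {d e : ℤ} (φ : O k d ⟶ O k e) :
    φ = 0 ∨ ∃ (m : ℕ) (f : MvPolynomial (Fin 4) k) (hf : f.IsHomogeneous m) (h : e = d + m),
      f ≠ 0 ∧ φ = mulHom hf h := by
  obtain ⟨q, hq⟩ := exists_ratio φ
  -- Applying $\varphi$ to $X_l^d$, with $X_l$ nonzero at $y$, writes $q$ as a fraction whose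
  -- homogeneous denominator does not vanish at $y$. The numerator exceeds it in degree by $e-d$.
  have loc : ∀ y : P3 k,
      ∃ (i j p n : ℕ) (a t : MvPolynomial (Fin 4) k) (l : Fin 4), (i : ℤ) = j + e ∧
        (p : ℤ) = n + d ∧ a.IsHomogeneous i ∧ t.IsHomogeneous j ∧
        y ∈ nonvanishing t ∧ y ∈ nonvanishing (X l : MvPolynomial (Fin 4) k) ∧
        q * algebraMap _ _ (X l ^ p * t) = algebraMap _ _ (X l ^ n * a) := by
    intro y
    obtain ⟨l, hl⟩ := exists_mem_nonvanishing_X y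
    obtain ⟨i, j, a, t, h, ha, ht, hty, h1, -⟩ :=
      exists_fraction (φ.app _ (generator k d l)) y hl
    refine ⟨i, j, d.toNat, (-d).toNat, a, t, l, h, by omega, ha, ht, hty, hl, ?_⟩
    rw [hq] at h1
    rw [map_mul, map_mul, ← h1, ← twistVal_generator d l y hl]
    ring
  obtain ⟨f, hf⟩ := exists_polynomial_of_forall_point q fun y => by
    obtain ⟨i, j, p, n, a, t, l, -, -, -, ht, hty, hl, h⟩ := loc y
    exact ⟨p + j, _, _, (isHomogeneous_X_pow l p).mul ht,
      mul_mem_nonvanishing (pow_mem_nonvanishing hl _) hty, h⟩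
  by_cases hf0 : f = 0
  · left
    refine Scheme.Modules.hom_ext _ _ fun U => ?_
    ext s
    refine twistSection_ext fun hy => ?_
    refine (hq U s _ hy).trans ?_
    rw [hf, hf0, map_zero, zero_mul]
    exact (twistVal_zero _ _).symm
  · right
    obtain ⟨i, j, p, n, a, t, l, h1, h2, ha, ht, hty, hl, h⟩ := loc (genericPt k)
    rw [hf, ← map_mul] at h
    have h3 := IsFractionRing.injective _ (FractionRing (MvPolynomial (Fin 4) k)) h
    have ht' := (isHomogeneous_X_pow (R := k) l p).mul ht
    have ha' := (isHomogeneous_X_pow (R := k) l n).mul ha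
    have h4 : f * (X l ^ p * t) ≠ 0 :=
      mul_ne_zero hf0 (mul_ne_zero (pow_ne_zero _ (X_ne_zero _))
        (genericPt_mem_nonvanishing.mp hty))
    -- As a factor of a nonzero homogeneous polynomial, $f$ is homogeneous; comparing degrees gives
    -- $m=e-d$.
    obtain ⟨m, hm⟩ := exists_isHomogeneous_of_mul (h3 ▸ ha') h4
    have h5 := (h3 ▸ ha' : (f * (X l ^ p * t)).IsHomogeneous _).inj_right (hm.mul ht') h4
    refine ⟨m, f, hm, by omega, hf0, ?_⟩
    refine Scheme.Modules.hom_ext _ _ fun U => ?_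
    ext s
    refine twistSection_ext fun hy => ?_
    exact (hq U s _ hy).trans ((congrArg (· * _) hf).trans (twistVal_mulHom _ _ _ _ _ _).symm)

theorem hom_eq_zero {d e : ℤ} (h : e < d) (φ : O k d ⟶ O k e) : φ = 0 := by
  rcases eq_zero_or_eq_mulHom φ with h0 | ⟨m, f, hf, h', -, -⟩
  · exact h0
  · omega

theorem mulHom_ne_zero {d e : ℤ} {m : ℕ} {f : MvPolynomial (Fin 4) k} (hf : f.IsHomogeneous m)
    (h : e = d + m) (hf0 : f ≠ 0) : mulHom hf h ≠ 0 := by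
  intro h0
  have h1 := twistVal_mulHom hf h _ (generator k d 0) (genericPt k) (genericPt_mem_nonvanishing_X 0)
  rw [h0] at h1
  refine mul_ne_zero ?_ (twistVal_generator_ne_zero d 0 _ _) (h1.symm.trans (twistVal_zero _ _))
  rwa [Ne, IsFractionRing.to_map_eq_zero_iff]

theorem mulHom_comp_comm {b a d : ℤ} {m : ℕ} {f g : MvPolynomial (Fin 4) k}
    (hf : f.IsHomogeneous m) (hg : g.IsHomogeneous m) (h : a = b + m) (h' : b = d + m) :
    mulHom hg h' ≫ mulHom hf h = mulHom hf h' ≫ mulHom hg h := by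
  refine Scheme.Modules.hom_ext _ _ fun U => ?_
  ext s
  refine twistSection_ext fun hy => ?_
  change twistVal ((mulHom hf h).app U ((mulHom hg h').app U s)) _ _ =
    twistVal ((mulHom hg h).app U ((mulHom hf h').app U s)) _ _
  simp only [twistVal_mulHom]
  ring

/-! ### The Koszul syzygy and the destabilising line subbundle sheaf. -/

/-- The Koszul relation between two morphisms `𝒪(b) ⟶ 𝒪(a)`. -/
theorem exists_relation {a b : ℤ} (hb : 0 ≤ b) (hab : 0 ≤ 2 * b - a) (φ₁ φ₂ : O k b ⟶ O k a) :
    ∃ (d : ℤ) (ψ₁ ψ₂ : O k d ⟶ O k b), 0 ≤ d ∧ ψ₁ ≫ φ₁ + ψ₂ ≫ φ₂ = 0 ∧ (ψ₁ ≠ 0 ∨ ψ₂ ≠ 0) := by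
  -- Multiplication by $1$ on $\mathcal O(b)$ is the relation used when one of the two maps is zero.
  have hid : mulHom (isHomogeneous_one (Fin 4) k) (add_zero b).symm ≠ 0 :=
    mulHom_ne_zero _ _ one_ne_zero
  rcases eq_zero_or_eq_mulHom φ₁ with rfl | ⟨m, f, hf, h, hf0, rfl⟩
  · exact ⟨b, mulHom (isHomogeneous_one (Fin 4) k) (add_zero b).symm, 0, hb,
      by simp, Or.inl hid⟩
  rcases eq_zero_or_eq_mulHom φ₂ with rfl | ⟨m', g, hg, h', hg0, rfl⟩
  · exact ⟨b, 0, mulHom (isHomogeneous_one (Fin 4) k) (add_zero b).symm, hb,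
      by simp, Or.inr hid⟩
  obtain rfl : m = m' := by omega
  -- The syzygy $(g,-f)$ has entries of degree $a-b$, so its source is $\mathcal O(b-(a-b))$.
  refine ⟨2 * b - a, mulHom hg (by omega), -mulHom hf (by omega), hab, ?_,
    Or.inl (mulHom_ne_zero _ _ hg0)⟩
  rw [Preadditive.neg_comp, mulHom_comp_comm, add_neg_cancel]

/-- The inclusion of a summand of `F^{⊕ n}`. -/
def copiesι (F : (P3 k).Modules) (n : ℕ) (j : Fin n) : F ⟶ copies F n :=
  have : Limits.HasFiniteBiproducts (P3 k).Modules := Abelian.hasFiniteBiproducts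
  biproduct.ι (fun _ : Fin n => F) j

/-- The projection of `F^{⊕ n}` to a summand. -/
def copiesπ (F : (P3 k).Modules) (n : ℕ) (j : Fin n) : copies F n ⟶ F :=
  have : Limits.HasFiniteBiproducts (P3 k).Modules := Abelian.hasFiniteBiproducts
  biproduct.π (fun _ : Fin n => F) j

theorem copiesι_copiesπ_self (F : (P3 k).Modules) (n : ℕ) (j : Fin n) :
    copiesι F n j ≫ copiesπ F n j = 𝟙 F :=
  have : Limits.HasFiniteBiproducts (P3 k).Modules := Abelian.hasFiniteBiproducts
  biproduct.ι_π_self (fun _ : Fin n => F) j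

theorem copiesι_copiesπ_of_ne (F : (P3 k).Modules) (n : ℕ) {i j : Fin n} (h : i ≠ j) :
    copiesι F n i ≫ copiesπ F n j = 0 :=
  have : Limits.HasFiniteBiproducts (P3 k).Modules := Abelian.hasFiniteBiproducts
  biproduct.ι_π_ne (fun _ : Fin n => F) h

theorem copies_hom_ext {D F : (P3 k).Modules} {n : ℕ} {φ ψ : D ⟶ copies F n}
    (h : ∀ j, φ ≫ copiesπ F n j = ψ ≫ copiesπ F n j) : φ = ψ :=
  have : Limits.HasFiniteBiproducts (P3 k).Modules := Abelian.hasFiniteBiproducts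
  biproduct.hom_ext (f := fun _ : Fin n => F) φ ψ h

/-- The cohomology of the monad contains some `𝒪(d)` with `d ≥ 0`. -/
theorem exists_mono_of_isMonadCohomology {n : ℕ} {A B C E : (P3 k).Modules}
    (hE : IsVectorBundle n E) {a b : ℤ} (hb : 0 ≤ b) (hab : 0 ≤ 2 * b - a)
    (hC : ∀ (d : ℤ) (φ : O k d ⟶ C), 0 ≤ d → φ = 0) (hA : ∀ φ : O k b ⟶ A, φ = 0)
    (h : IsMonadCohomology C (copies (O k b) 2 ⊞ B) (O k a ⊞ A) E) :
    ∃ (d : ℤ) (i : O k d ⟶ E), 0 ≤ d ∧ Mono i := by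
  obtain ⟨α, β, w, hα, hβ, ⟨e⟩⟩ := h
  let ι := copiesι (O k b) 2
  obtain ⟨d, ψ₁, ψ₂, hd, hψ, hψ0⟩ := exists_relation hb hab (ι 0 ≫ biprod.inl ≫ β ≫ biprod.fst)
    (ι 1 ≫ biprod.inl ≫ β ≫ biprod.fst)
  let ψ : O k d ⟶ copies (O k b) 2 ⊞ B := (ψ₁ ≫ ι 0 + ψ₂ ≫ ι 1) ≫ biprod.inl
  have hψβ : ψ ≫ β = 0 := by
    apply biprod.hom_ext
    · simpa [ψ] using hψ
    · have h0 := hA (ι 0 ≫ biprod.inl ≫ β ≫ biprod.snd)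
      have h1 := hA (ι 1 ≫ biprod.inl ≫ β ≫ biprod.snd)
      simp [ψ, h0, h1]
  have hψne : ψ ≠ 0 := by
    intro h0
    have h1 : ψ ≫ biprod.fst = ψ₁ ≫ ι 0 + ψ₂ ≫ ι 1 := by simp [ψ]
    rw [h0, zero_comp] at h1
    rcases hψ0 with h2 | h2
    · exact h2 (by simpa [ι, copiesι_copiesπ_self, copiesι_copiesπ_of_ne] using
        (congrArg (· ≫ copiesπ _ _ 0) h1).symm)
    · exact h2 (by simpa [ι, copiesι_copiesπ_self, copiesι_copiesπ_of_ne] using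
        (congrArg (· ≫ copiesπ _ _ 1) h1).symm)
  let S := ShortComplex.mk α β w
  let κ : O k d ⟶ S.cycles := S.liftCycles ψ hψβ
  have hκ : κ ≫ S.homologyπ ≠ 0 := by
    intro h0
    have : Mono S.f := hα
    have : Mono S.toCycles := mono_of_mono_fac S.toCycles_i
    -- Since $\alpha$ is injective, a map to the cycles that dies in cohomology lifts to $C$, where
    -- it is zero because $d\ge 0$. This would force $\psi=0$.
    let T := ShortComplex.mk S.toCycles S.homologyπ S.toCycles_comp_homologyπ
    have hT : T.Exact := T.exact_of_g_is_cokernel S.homologyIsCokernel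
    have : Mono T.f := ‹Mono S.toCycles›
    have h1 : hT.lift κ h0 ≫ S.toCycles = κ := hT.lift_f κ h0
    rw [hC d (hT.lift κ h0) hd, zero_comp] at h1
    apply hψne
    rw [← S.liftCycles_i ψ hψβ]
    change κ ≫ _ = 0
    rw [← h1, zero_comp]
  refine ⟨d, κ ≫ S.homologyπ ≫ e.inv, hd, mono_of_ne_zero hE _ fun h0 => hκ ?_⟩
  rw [← cancel_mono e.inv, zero_comp, Category.assoc, h0]

theorem not_isStableRankTwo_of_mono {E : (P3 k).Modules} {c d : ℤ}
    (hc : HasFirstChernClass 2 E c) (h : c ≤ 2 * d) (i : O k d ⟶ E) (hi : Mono i) :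
    ¬ IsStableRankTwo E := fun hE =>
  absurd (hE.2 c hc _ d i ⟨Iso.refl _⟩ hi) (not_lt.mpr h)

theorem hom_copies_eq_zero {d e : ℤ} (h : e < d) (n : ℕ) (φ : O k d ⟶ copies (O k e) n) :
    φ = 0 :=
  copies_hom_ext fun _ => (hom_eq_zero h _).trans zero_comp.symm

theorem hom_biprod_eq_zero {D M N : (P3 k).Modules} (φ : D ⟶ M ⊞ N)
    (hM : ∀ ψ : D ⟶ M, ψ = 0) (hN : ∀ ψ : D ⟶ N, ψ = 0) : φ = 0 :=
  biprod.hom_ext _ _ ((hM _).trans zero_comp.symm) ((hN _).trans zero_comp.symm)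

end Morphisms

end HorrocksMonads

end

theorem mainTheorem10 {k : Type*} [Field k] :
    (∀ (a₁ a₂ b : ℤ) (g : ℕ), 0 ≤ a₁ → a₁ < b → b ≤ a₂ → 0 ≤ 2 * b - a₂ →
      ∀ B E : (HorrocksMonads.P3 k).Modules,
        HorrocksMonads.IsVectorBundle (2 * g + 2) B →
        HorrocksMonads.IsVectorBundle 2 E →
        (∃ c : ℤ, HorrocksMonads.HasFirstChernClass 2 E c ∧ c ≤ 0) →
        HorrocksMonads.IsMonadCohomology
          (HorrocksMonads.O k (-a₂ - 1) ⊞ HorrocksMonads.copies (HorrocksMonads.O k (-a₁ - 1)) g)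
          (HorrocksMonads.copies (HorrocksMonads.O k b) 2 ⊞ B)
          (HorrocksMonads.O k a₂ ⊞ HorrocksMonads.copies (HorrocksMonads.O k a₁) g) E →
        ¬ HorrocksMonads.IsStableRankTwo E) ∧
    (∀ E : (HorrocksMonads.P3 k).Modules,
      HorrocksMonads.IsVectorBundle 2 E →
      HorrocksMonads.HasFirstChernClass 2 E (-1) →
      HorrocksMonads.IsMonadCohomology
        (HorrocksMonads.O k (-5) ⊞ HorrocksMonads.O k (-2))
        (HorrocksMonads.copies (HorrocksMonads.O k 2) 2 ⊞ (HorrocksMonads.O k 0 ⊞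
          (HorrocksMonads.O k (-1) ⊞ HorrocksMonads.copies (HorrocksMonads.O k (-3)) 2)))
        (HorrocksMonads.O k 4 ⊞ HorrocksMonads.O k 1) E →
      ¬ HorrocksMonads.IsStableRankTwo E) := by
  refine ⟨fun a₁ a₂ b g h₁ h₂ h₃ h₄ B E _ hE ⟨c, hc, hc0⟩ h => ?_, fun E hE hc h => ?_⟩
  · obtain ⟨d, i, hd, hi⟩ := HorrocksMonads.exists_mono_of_isMonadCohomology hE (by omega) h₄
      (fun d φ hd => HorrocksMonads.hom_biprod_eq_zero φ
        (HorrocksMonads.hom_eq_zero (by omega))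
        (HorrocksMonads.hom_copies_eq_zero (by omega) g))
      (HorrocksMonads.hom_copies_eq_zero h₂ g) h
    exact HorrocksMonads.not_isStableRankTwo_of_mono hc (by omega) i hi
  -- Here $a=4$ and $b=2$, the boundary case $2b-a=0$. The terms $\mathcal O(1)$ and $\mathcal
  -- O(-2)$ are plain summands rather than `copies`, so the general lemma is applied directly.
  · obtain ⟨d, i, hd, hi⟩ := HorrocksMonads.exists_mono_of_isMonadCohomology hE
      (by norm_num) (by norm_num)
      (fun d φ hd => HorrocksMonads.hom_biprod_eq_zero φ
        (HorrocksMonads.hom_eq_zero (by omega)) (HorrocksMonads.hom_eq_zero (by omega)))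
      (HorrocksMonads.hom_eq_zero (by norm_num)) h
    exact HorrocksMonads.not_isStableRankTwo_of_mono hc (by omega) i hi
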